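/- Let $H$ be a finite-dimensional complex Hilbert space and let $V\in B(H\otimes H)$ be a multiplicative unitary, that is, a unitary satisfying the pentagon equation $V_{12}V_{13}V_{23}=V_{23}V_{12}$ on $H\otimes H\otimes H$. Let $$S=\{(\omega\otimes\mathrm{id})(V):\omega\in B(H)^*\},\qquad \widehat S=\{(\mathrm{id}\otimes\rho)(V):\rho\in B(H)^*\}$$ be the associated concrete Hopf C*-subalgebras of $B(H)$, where $S$ carries the coproduct $\delta(x)=V(x\otimes 1)V^*\in S\otimes S$, and where $S$ and $\widehat S$ are in duality through the non-degenerate pairing $\beta\big((\omega\otimes\mathrm{id})(V),(\mathrm{id}\otimes\rho)(V)\big)=(\omega\otimes\rho)(V)$. Let $u\in B(H)$ be a unitary such that $\alpha(x)=uxu^*$ defines a Hopf *-automorphism of $S$, that is, a *-automorphism of $S$ with $\delta\circ\alpha=(\alpha\otimes\alpha)\circ\delta$. Suppose that its action $\widehat\alpha$ on the dual $\widehat S$, determined by $\beta(x,\widehat\alpha(y))=\beta(\alpha(x),y)$ for $x\in S$, $y\in\widehat S$, is inner, that is, $\widehat\alpha(y)=gyg^{-1}$ for some invertible $g\in\widehat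 S$. Then there is a unitary $\widehat u\in\widehat S$ such that $\widehat u\otimes u$ commutes with $V$. -/

import Mathlib

open scoped TensorProduct

noncomputable section

/-! ### Slice maps and legs of operators on tensor products -/

section Slices

variable {E F : Type*} [AddCommGroup E] [Module ℂ E] [FiniteDimensional ℂ E]
  [AddCommGroup F] [Module ℂ F] [FiniteDimensional ℂ F]

/-- The slice map `ω ⊗ id : B(E ⊗ F) → B(F)` of a linear functional `ω` on `B(E)`. -/
def sliceFst (ω : Module.Dual ℂ (Module.End ℂ E)) :
    Module.End ℂ (E ⊗[ℂ] F) →ₗ[ℂ] Module.End ℂ F :=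
  (TensorProduct.lid ℂ (Module.End ℂ F)).toLinearMap ∘ₗ
    LinearMap.rTensor (Module.End ℂ F) ω ∘ₗ (homTensorHomEquiv ℂ E F E F).symm.toLinearMap

/-- The slice map `id ⊗ ω : B(E ⊗ F) → B(E)` of a linear functional `ω` on `B(F)`. -/
def sliceSnd (ω : Module.Dual ℂ (Module.End ℂ F)) :
    Module.End ℂ (E ⊗[ℂ] F) →ₗ[ℂ] Module.End ℂ E :=
  (TensorProduct.rid ℂ (Module.End ℂ E)).toLinearMap ∘ₗ
    LinearMap.lTensor (Module.End ℂ E) ω ∘ₗ (homTensorHomEquiv ℂ E F E F).symm.toLinearMap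

theorem homTensorHomEquiv_symm_map (a : Module.End ℂ E) (b : Module.End ℂ F) :
    (homTensorHomEquiv ℂ E F E F).symm (TensorProduct.map a b) = a ⊗ₜ b := by
  rw [LinearEquiv.symm_apply_eq, homTensorHomEquiv_apply]; rfl

theorem sliceFst_map (ω : Module.Dual ℂ (Module.End ℂ E)) (a : Module.End ℂ E)
    (b : Module.End ℂ F) : sliceFst ω (TensorProduct.map a b) = ω a • b := by
  simp [sliceFst, homTensorHomEquiv_symm_map]

theorem sliceSnd_map (ω : Module.Dual ℂ (Module.End ℂ F)) (a : Module.End ℂ E)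
    (b : Module.End ℂ F) : sliceSnd ω (TensorProduct.map a b) = ω b • a := by
  simp [sliceSnd, homTensorHomEquiv_symm_map]

theorem endTensor_induction {P : Module.End ℂ (E ⊗[ℂ] F) → Prop}
    (h0 : P 0) (hm : ∀ a b, P (TensorProduct.map a b)) (ha : ∀ X Y, P X → P Y → P (X + Y))
    (X : Module.End ℂ (E ⊗[ℂ] F)) : P X := by
  obtain ⟨t, rfl⟩ := (homTensorHomEquiv ℂ E F E F).surjective X
  induction t using TensorProduct.induction_on with
  | zero => simpa using h0
  | tmul a b =>
    rw [← homTensorHomEquiv_symm_map, LinearEquiv.apply_symm_apply]; exact hm a b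
  | add s t hs ht => rw [map_add]; exact ha _ _ hs ht

theorem eq_sum_map_sliceFst {ι : Type*} [Fintype ι] (b : Module.Basis ι ℂ (Module.End ℂ E))
    (X : Module.End ℂ (E ⊗[ℂ] F)) :
    X = ∑ i, TensorProduct.map (b i) (sliceFst (b.coord i) X) := by
  induction X using endTensor_induction with
  | h0 => simp
  | hm x y =>
    have h := congrArg (fun z => TensorProduct.mapBilinear (.id ℂ) E F E F z y) (b.sum_repr x)
    simp only [map_sum, map_smul, LinearMap.sum_apply, LinearMap.smul_apply,
      TensorProduct.mapBilinear_apply] at h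
    simp [sliceFst_map, TensorProduct.map_smul_right, h]
  | ha X Y hX hY =>
    conv_lhs => rw [hX, hY]
    simp [TensorProduct.map_add_right, Finset.sum_add_distrib]

theorem eq_sum_map_sliceSnd {ι : Type*} [Fintype ι] (b : Module.Basis ι ℂ (Module.End ℂ F))
    (X : Module.End ℂ (E ⊗[ℂ] F)) :
    X = ∑ i, TensorProduct.map (sliceSnd (b.coord i) X) (b i) := by
  induction X using endTensor_induction with
  | h0 => simp
  | hm x y =>
    have h := congrArg (fun z => TensorProduct.mapBilinear (.id ℂ) E F E F x z) (b.sum_repr y)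
    simp only [map_sum, map_smul, TensorProduct.mapBilinear_apply] at h
    simp [sliceSnd_map, TensorProduct.map_smul_left, h]
  | ha X Y hX hY =>
    conv_lhs => rw [hX, hY]
    simp [TensorProduct.map_add_left, Finset.sum_add_distrib]

theorem apply_sliceFst_eq (ω : Module.Dual ℂ (Module.End ℂ E)) (ρ : Module.Dual ℂ (Module.End ℂ F))
    (X : Module.End ℂ (E ⊗[ℂ] F)) : ρ (sliceFst ω X) = ω (sliceSnd ρ X) := by
  induction X using endTensor_induction with
  | h0 => simp
  | hm x y => simp [sliceFst_map, sliceSnd_map, mul_comm]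
  | ha X Y hX hY => simp [hX, hY]

end Slices

section Legs

variable {H : Type*} [AddCommGroup H] [Module ℂ H]

/-- `X₁₂ = X ⊗ 1` on `H ⊗ H ⊗ H`. -/
def leg12 (X : Module.End ℂ (H ⊗[ℂ] H)) : Module.End ℂ (H ⊗[ℂ] (H ⊗[ℂ] H)) :=
  (TensorProduct.assoc ℂ H H H).toLinearMap ∘ₗ LinearMap.rTensor H X ∘ₗ
    (TensorProduct.assoc ℂ H H H).symm.toLinearMap

/-- `X₂₃ = 1 ⊗ X` on `H ⊗ H ⊗ H`. -/
def leg23 (X : Module.End ℂ (H ⊗[ℂ] H)) : Module.End ℂ (H ⊗[ℂ] (H ⊗[ℂ] H)) :=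
  LinearMap.lTensor H X

/-- `X₁₃ = (1 ⊗ Σ) X₁₂ (1 ⊗ Σ)` on `H ⊗ H ⊗ H`, where `Σ` is the flip of `H ⊗ H`. -/
def leg13 (X : Module.End ℂ (H ⊗[ℂ] H)) : Module.End ℂ (H ⊗[ℂ] (H ⊗[ℂ] H)) :=
  LinearMap.lTensor H (TensorProduct.comm ℂ H H).toLinearMap ∘ₗ leg12 X ∘ₗ
    LinearMap.lTensor H (TensorProduct.comm ℂ H H).toLinearMap

theorem leg12_add (X Y : Module.End ℂ (H ⊗[ℂ] H)) : leg12 (X + Y) = leg12 X + leg12 Y := by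
  simp [leg12, LinearMap.rTensor_add, LinearMap.add_comp, LinearMap.comp_add]

theorem leg23_add (X Y : Module.End ℂ (H ⊗[ℂ] H)) : leg23 (X + Y) = leg23 X + leg23 Y := by
  simp [leg23, LinearMap.lTensor_add]

theorem leg13_add (X Y : Module.End ℂ (H ⊗[ℂ] H)) : leg13 (X + Y) = leg13 X + leg13 Y := by
  simp [leg13, leg12_add, LinearMap.add_comp, LinearMap.comp_add]

theorem leg12_zero : leg12 (0 : Module.End ℂ (H ⊗[ℂ] H)) = 0 := by simp [leg12]

theorem leg23_zero : leg23 (0 : Module.End ℂ (H ⊗[ℂ] H)) = 0 := by simp [leg23]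

theorem leg13_zero : leg13 (0 : Module.End ℂ (H ⊗[ℂ] H)) = 0 := by simp [leg13, leg12_zero]

theorem leg12_one : leg12 (1 : Module.End ℂ (H ⊗[ℂ] H)) = 1 := by
  refine LinearMap.ext fun x => ?_
  simp [leg12, Module.End.one_eq_id]

theorem leg23_one : leg23 (1 : Module.End ℂ (H ⊗[ℂ] H)) = 1 := by
  simp [leg23, Module.End.one_eq_id]

theorem leg12_mul (X Y : Module.End ℂ (H ⊗[ℂ] H)) : leg12 (X * Y) = leg12 X * leg12 Y := by
  refine LinearMap.ext fun x => ?_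
  simp [leg12, Module.End.mul_eq_comp, LinearMap.rTensor_comp]

theorem leg23_mul (X Y : Module.End ℂ (H ⊗[ℂ] H)) : leg23 (X * Y) = leg23 X * leg23 Y := by
  simp [leg23, Module.End.mul_eq_comp, LinearMap.lTensor_comp]

theorem leg12_map (a b : Module.End ℂ H) :
    leg12 (TensorProduct.map a b) = TensorProduct.map a (TensorProduct.map b 1) := by
  refine TensorProduct.ext_threefold' fun x y z => ?_
  simp [leg12]

theorem leg23_map (a b : Module.End ℂ H) :
    leg23 (TensorProduct.map a b) = TensorProduct.map 1 (TensorProduct.map a b) := rfl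

theorem leg13_map (a b : Module.End ℂ H) :
    leg13 (TensorProduct.map a b) = TensorProduct.map a (TensorProduct.map 1 b) := by
  refine TensorProduct.ext_threefold' fun x y z => ?_
  simp [leg13, leg12_map]

variable [FiniteDimensional ℂ H]

theorem slice_leg13_mul_leg23 (ω ρ : Module.Dual ℂ (Module.End ℂ H))
    (X Y : Module.End ℂ (H ⊗[ℂ] H)) :
    sliceFst ρ (sliceFst ω (leg13 X * leg23 Y)) = sliceFst ω X * sliceFst ρ Y := by
  induction X using endTensor_induction with
  | h0 => simp [leg13_zero]
  | ha X X' hX hX' => simp [leg13_add, add_mul, hX, hX']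
  | hm a b =>
    induction Y using endTensor_induction with
    | h0 => simp [leg23_zero]
    | ha Y Y' hY hY' => simp [leg23_add, mul_add, hY, hY']
    | hm c d =>
      rw [leg13_map, leg23_map, ← TensorProduct.map_mul, ← TensorProduct.map_mul]
      simp [sliceFst_map, smul_smul, mul_comm]

theorem slice_leg12_mul_leg13 (ω ρ : Module.Dual ℂ (Module.End ℂ H))
    (X Y : Module.End ℂ (H ⊗[ℂ] H)) :
    sliceSnd (ρ ∘ₗ sliceFst ω) (leg12 X * leg13 Y) = sliceSnd ω X * sliceSnd ρ Y := by
  induction X using endTensor_induction with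
  | h0 => simp [leg12_zero]
  | ha X X' hX hX' => simp [leg12_add, add_mul, hX, hX']
  | hm a b =>
    induction Y using endTensor_induction with
    | h0 => simp [leg13_zero]
    | ha Y Y' hY hY' => simp [leg13_add, mul_add, hY, hY']
    | hm c d =>
      rw [leg12_map, leg13_map, ← TensorProduct.map_mul, ← TensorProduct.map_mul]
      simp [sliceSnd_map, sliceFst_map, smul_smul, mul_comm]

theorem slice_leg12_leg23_leg12 (ω ρ : Module.Dual ℂ (Module.End ℂ H))
    (P X Q : Module.End ℂ (H ⊗[ℂ] H)) :
    sliceFst ρ (sliceFst ω (leg12 P * leg23 X * leg12 Q)) =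
      sliceFst (ρ ∘ₗ sliceFst ω ∘ₗ LinearMap.mulLeft ℂ P ∘ₗ LinearMap.mulRight ℂ Q ∘ₗ
        TensorProduct.mapBilinear (.id ℂ) H H H H 1) X := by
  induction X using endTensor_induction with
  | h0 => simp [leg23_zero]
  | ha X X' hX hX' => simp [leg23_add, mul_add, add_mul, hX, hX']
  | hm a b =>
    rw [sliceFst_map]
    induction P using endTensor_induction with
    | h0 => simp [leg12_zero]
    | ha P P' hP hP' => simp [leg12_add, add_mul, add_smul, hP, hP']
    | hm c d =>
      induction Q using endTensor_induction with
      | h0 => simp [leg12_zero]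
      | ha Q Q' hQ hQ' => simp [leg12_add, mul_add, add_smul, hQ, hQ']
      | hm e f =>
        rw [leg12_map, leg23_map, leg12_map]
        simp [← TensorProduct.map_mul, sliceFst_map, smul_smul, mul_assoc]

theorem slice_leg23_leg12_leg23 (ω : Module.Dual ℂ (Module.End ℂ (H ⊗[ℂ] H)))
    (P X Q : Module.End ℂ (H ⊗[ℂ] H)) :
    sliceSnd ω (leg23 P * leg12 X * leg23 Q) =
      sliceSnd (ω ∘ₗ LinearMap.mulLeft ℂ P ∘ₗ LinearMap.mulRight ℂ Q ∘ₗ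
        (TensorProduct.mapBilinear (.id ℂ) H H H H).flip 1) X := by
  induction X using endTensor_induction with
  | h0 => simp [leg12_zero]
  | ha X X' hX hX' => simp [leg12_add, mul_add, add_mul, hX, hX']
  | hm a b =>
    have h : leg23 P * leg12 (TensorProduct.map a b) * leg23 Q =
        TensorProduct.map a (P * TensorProduct.map b 1 * Q) := by
      rw [leg12_map]
      refine TensorProduct.ext_threefold' fun x y z => ?_
      simp [leg23]
    rw [h, sliceSnd_map, sliceSnd_map]
    simp [mul_assoc]

theorem sliceFst_leg23_leg12_leg23 (ω : Module.Dual ℂ (Module.End ℂ H))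
    (P X Q : Module.End ℂ (H ⊗[ℂ] H)) :
    sliceFst ω (leg23 P * leg12 X * leg23 Q) = P * TensorProduct.map (sliceFst ω X) 1 * Q := by
  induction X using endTensor_induction with
  | h0 => simp [leg12_zero]
  | ha X X' hX hX' => simp [leg12_add, mul_add, add_mul, hX, hX', TensorProduct.map_add_left]
  | hm a b =>
    have h : leg23 P * leg12 (TensorProduct.map a b) * leg23 Q =
        TensorProduct.map a (P * TensorProduct.map b 1 * Q) := by
      rw [leg12_map]
      refine TensorProduct.ext_threefold' fun x y z => ?_
      simp [leg23]
    rw [h, sliceFst_map, sliceFst_map]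
    simp [TensorProduct.map_smul_left]

end Legs

section Closure

theorem one_mem_and_inv_mem {R : Type*} [Ring R] [Algebra ℂ R] [FiniteDimensional ℂ R]
    (M : Submodule ℂ R) (hM : ∀ x ∈ M, ∀ y ∈ M, x * y ∈ M) {v w : R} (hv : v ∈ M)
    (hwv : w * v = 1) : 1 ∈ M ∧ w ∈ M := by
  let f : M →ₗ[ℂ] M := (LinearMap.mulLeft ℂ v).restrict fun x hx => hM v hv x hx
  have hf : Function.Injective f := by
    intro x y hxy
    have h : v * (x : R) = v * y := congrArg Subtype.val hxy
    apply Subtype.ext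
    calc (x : R) = w * (v * x) := by rw [← mul_assoc, hwv, one_mul]
      _ = w * (v * y) := by rw [h]
      _ = y := by rw [← mul_assoc, hwv, one_mul]
  have key : ∀ z ∈ M, w * z ∈ M := by
    intro z hz
    obtain ⟨x, hx⟩ := LinearMap.injective_iff_surjective.mp hf ⟨z, hz⟩
    have h : v * (x : R) = z := congrArg Subtype.val hx
    have h' : w * z = x := by rw [← h, ← mul_assoc, hwv, one_mul]
    rw [h']; exact x.2
  have h1 : (1 : R) ∈ M := hwv ▸ key v hv
  exact ⟨h1, by simpa using key 1 h1⟩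

variable {E F : Type*} [NormedAddCommGroup E] [InnerProductSpace ℂ E] [FiniteDimensional ℂ E]
  [NormedAddCommGroup F] [InnerProductSpace ℂ F] [FiniteDimensional ℂ F]

theorem conj_functional_exists {R : Type*} [Ring R] [StarRing R] [Algebra ℂ R] [StarModule ℂ R]
    (ω : Module.Dual ℂ R) : ∃ ρ : Module.Dual ℂ R, ∀ x, ρ x = star (ω (star x)) :=
  ⟨{ toFun := fun x => star (ω (star x))
     map_add' := by simp
     map_smul' := by simp }, fun _ => rfl⟩

theorem star_map_tensor (a : Module.End ℂ E) (b : Module.End ℂ F) :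
    star (TensorProduct.map a b : Module.End ℂ (E ⊗[ℂ] F)) =
      TensorProduct.map (star a) (star b) :=
  TensorProduct.adjoint_map a b

theorem exists_star_sliceFst (ω : Module.Dual ℂ (Module.End ℂ E)) :
    ∃ ρ : Module.Dual ℂ (Module.End ℂ E), ∀ X : Module.End ℂ (E ⊗[ℂ] F),
      star (sliceFst ω X) = sliceFst ρ (star X) := by
  obtain ⟨ρ, hρ⟩ := conj_functional_exists ω
  refine ⟨ρ, fun X => ?_⟩
  induction X using endTensor_induction with
  | h0 =>
    have h : star (0 : Module.End ℂ (E ⊗[ℂ] F)) = 0 :=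
      star_zero (Module.End ℂ (E ⊗[ℂ] F))
    rw [h]; simp
  | ha X Y hX hY =>
    have h : star (X + Y) = star X + star Y := star_add X Y
    rw [h]; simp [hX, hY]
  | hm a b => simp [star_map_tensor, sliceFst_map, hρ]

theorem exists_star_sliceSnd (ω : Module.Dual ℂ (Module.End ℂ F)) :
    ∃ ρ : Module.Dual ℂ (Module.End ℂ F), ∀ X : Module.End ℂ (E ⊗[ℂ] F),
      star (sliceSnd ω X) = sliceSnd ρ (star X) := by
  obtain ⟨ρ, hρ⟩ := conj_functional_exists ω
  refine ⟨ρ, fun X => ?_⟩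
  induction X using endTensor_induction with
  | h0 =>
    have h : star (0 : Module.End ℂ (E ⊗[ℂ] F)) = 0 :=
      star_zero (Module.End ℂ (E ⊗[ℂ] F))
    rw [h]; simp
  | ha X Y hX hY =>
    have h : star (X + Y) = star X + star Y := star_add X Y
    rw [h]; simp [hX, hY]
  | hm a b => simp [star_map_tensor, sliceSnd_map, hρ]

theorem exists_dual_one {R : Type*} [Ring R] [Algebra ℂ R] :
    ∃ ω : Module.Dual ℂ R, ω 1 • (1 : R) = 1 := by
  by_cases h : (1 : R) = 0
  · exact ⟨0, by simp [h]⟩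
  · obtain ⟨ω, hω⟩ := Module.Projective.exists_dual_ne_zero ℂ h
    exact ⟨(ω 1)⁻¹ • ω, by simp [hω]⟩

/-- If the slices `(ω ⊗ id)(V)` of the unitary `V` form a subspace `W` closed under products,
then `W` contains `1` and is closed under `*`. -/
theorem sliceFst_closed (W : Submodule ℂ (Module.End ℂ E))
    (hW : ∀ x ∈ W, ∀ y ∈ W, x * y ∈ W) (V : Module.End ℂ (E ⊗[ℂ] E)) (hV : star V * V = 1)
    (hVW : ∀ x, x ∈ W ↔ ∃ ω, sliceFst ω V = x) : 1 ∈ W ∧ ∀ x ∈ W, star x ∈ W := by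
  let M : Submodule ℂ (Module.End ℂ (E ⊗[ℂ] E)) := ⨅ ω, W.comap (sliceFst ω)
  have memM : ∀ X, X ∈ M ↔ ∀ ω, sliceFst ω X ∈ W := by simp [M]
  have hM : ∀ x ∈ M, ∀ y ∈ M, x * y ∈ M := by
    intro X hX Y hY
    rw [memM] at *
    intro ω
    let b := Module.finBasis ℂ (Module.End ℂ E)
    rw [eq_sum_map_sliceFst b X, eq_sum_map_sliceFst b Y, Finset.sum_mul_sum, map_sum]
    refine W.sum_mem fun i _ => ?_
    rw [map_sum]
    refine W.sum_mem fun j _ => ?_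
    rw [← TensorProduct.map_mul, sliceFst_map]
    exact W.smul_mem _ (hW _ (hX _) _ (hY _))
  obtain ⟨h1, hs⟩ := one_mem_and_inv_mem M hM ((memM V).2 fun ω => (hVW _).2 ⟨ω, rfl⟩) hV
  constructor
  · obtain ⟨ω, hω⟩ := exists_dual_one (R := Module.End ℂ E)
    have h := (memM 1).1 h1 ω
    rwa [← TensorProduct.map_one, sliceFst_map, hω] at h
  · intro x hx
    obtain ⟨ω, rfl⟩ := (hVW x).1 hx
    obtain ⟨ρ, hρ⟩ := exists_star_sliceFst (F := E) ω
    rw [hρ]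
    exact (memM _).1 hs ρ

/-- If the slices `(id ⊗ ω)(V)` of the unitary `V` form a subspace `W` closed under products,
then `W` contains `1` and is closed under `*`. -/
theorem sliceSnd_closed (W : Submodule ℂ (Module.End ℂ E))
    (hW : ∀ x ∈ W, ∀ y ∈ W, x * y ∈ W) (V : Module.End ℂ (E ⊗[ℂ] E)) (hV : star V * V = 1)
    (hVW : ∀ x, x ∈ W ↔ ∃ ω, sliceSnd ω V = x) : 1 ∈ W ∧ ∀ x ∈ W, star x ∈ W := by
  let M : Submodule ℂ (Module.End ℂ (E ⊗[ℂ] E)) := ⨅ ω, W.comap (sliceSnd ω)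
  have memM : ∀ X, X ∈ M ↔ ∀ ω, sliceSnd ω X ∈ W := by simp [M]
  have hM : ∀ x ∈ M, ∀ y ∈ M, x * y ∈ M := by
    intro X hX Y hY
    rw [memM] at *
    intro ω
    let b := Module.finBasis ℂ (Module.End ℂ E)
    rw [eq_sum_map_sliceSnd b X, eq_sum_map_sliceSnd b Y, Finset.sum_mul_sum, map_sum]
    refine W.sum_mem fun i _ => ?_
    rw [map_sum]
    refine W.sum_mem fun j _ => ?_
    rw [← TensorProduct.map_mul, sliceSnd_map]
    exact W.smul_mem _ (hW _ (hX _) _ (hY _))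
  obtain ⟨h1, hs⟩ := one_mem_and_inv_mem M hM ((memM V).2 fun ω => (hVW _).2 ⟨ω, rfl⟩) hV
  constructor
  · obtain ⟨ω, hω⟩ := exists_dual_one (R := Module.End ℂ E)
    have h := (memM 1).1 h1 ω
    rwa [← TensorProduct.map_one, sliceSnd_map, hω] at h
  · intro x hx
    obtain ⟨ω, rfl⟩ := (hVW x).1 hx
    obtain ⟨ρ, hρ⟩ := exists_star_sliceSnd (E := E) ω
    rw [hρ]
    exact (memM _).1 hs ρ

end Closure

/-! ### Multiplicative unitaries and their Hopf C*-algebras -/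

/-- A multiplicative unitary on the finite-dimensional Hilbert space `H`: a unitary operator on
`H ⊗ H` that satisfies the pentagon equation `V₁₂ V₁₃ V₂₃ = V₂₃ V₁₂`. -/
structure MultiplicativeUnitary (H : Type*) [NormedAddCommGroup H] [InnerProductSpace ℂ H]
    [FiniteDimensional ℂ H] where
  /-- the underlying operator -/
  op : Module.End ℂ (H ⊗[ℂ] H)
  mem_unitary : op ∈ unitary (Module.End ℂ (H ⊗[ℂ] H))
  pentagon : leg12 op * leg13 op * leg23 op = leg23 op * leg12 op

namespace MultiplicativeUnitary

variable {H : Type*} [NormedAddCommGroup H] [InnerProductSpace ℂ H] [FiniteDimensional ℂ H]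
  (V : MultiplicativeUnitary H)

theorem star_mul_op : star V.op * V.op = 1 := (Unitary.mem_iff.mp V.mem_unitary).1

theorem op_mul_star : V.op * star V.op = 1 := (Unitary.mem_iff.mp V.mem_unitary).2

/-- The map `ω ↦ (ω ⊗ id)(V)`. -/
def sliceFstMap : Module.Dual ℂ (Module.End ℂ H) →ₗ[ℂ] Module.End ℂ H where
  toFun ω := sliceFst ω V.op
  map_add' ω ρ := by simp [sliceFst, LinearMap.rTensor_add]
  map_smul' c ω := by simp [sliceFst, LinearMap.rTensor_smul]

/-- The map `ω ↦ (id ⊗ ω)(V)`. -/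
def sliceSndMap : Module.Dual ℂ (Module.End ℂ H) →ₗ[ℂ] Module.End ℂ H where
  toFun ω := sliceSnd ω V.op
  map_add' ω ρ := by simp [sliceSnd, LinearMap.lTensor_add]
  map_smul' c ω := by simp [sliceSnd, LinearMap.lTensor_smul]

theorem mul_mem_range_sliceFstMap (x : Module.End ℂ H)
    (hx : x ∈ LinearMap.range V.sliceFstMap) (y : Module.End ℂ H)
    (hy : y ∈ LinearMap.range V.sliceFstMap) :
    x * y ∈ LinearMap.range V.sliceFstMap := by
  obtain ⟨ω, rfl⟩ := hx
  obtain ⟨ρ, rfl⟩ := hy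
  have h : leg13 V.op * leg23 V.op = leg12 (star V.op) * leg23 V.op * leg12 V.op := by
    rw [mul_assoc, ← V.pentagon, mul_assoc (leg12 V.op), ← mul_assoc (leg12 (star V.op)),
      ← leg12_mul, V.star_mul_op, leg12_one, one_mul]
  exact ⟨_, (slice_leg12_leg23_leg12 ω ρ _ _ _).symm.trans
    (h ▸ slice_leg13_mul_leg23 ω ρ V.op V.op)⟩

theorem leg12_mul_leg13 :
    leg12 V.op * leg13 V.op = leg23 V.op * leg12 V.op * leg23 (star V.op) := by
  rw [← V.pentagon, mul_assoc _ (leg23 V.op), ← leg23_mul, V.op_mul_star, leg23_one, mul_one]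

theorem mul_mem_range_sliceSndMap (x : Module.End ℂ H)
    (hx : x ∈ LinearMap.range V.sliceSndMap) (y : Module.End ℂ H)
    (hy : y ∈ LinearMap.range V.sliceSndMap) :
    x * y ∈ LinearMap.range V.sliceSndMap := by
  obtain ⟨ω, rfl⟩ := hx
  obtain ⟨ρ, rfl⟩ := hy
  exact ⟨_, (slice_leg23_leg12_leg23 _ _ _ _).symm.trans
    (V.leg12_mul_leg13 ▸ slice_leg12_mul_leg13 ω ρ V.op V.op)⟩

/-- The concrete C*-algebra `S = {(ω ⊗ id)(V) : ω ∈ B(H)*} ⊆ B(H)`. -/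
def S : StarSubalgebra ℂ (Module.End ℂ H) where
  carrier := {x | ∃ ω : Module.Dual ℂ (Module.End ℂ H), sliceFst ω V.op = x}
  mul_mem' := fun {x y} hx hy => V.mul_mem_range_sliceFstMap x hx y hy
  add_mem' := fun {_ _} hx hy => (LinearMap.range V.sliceFstMap).add_mem hx hy
  algebraMap_mem' c := by
    rw [Algebra.algebraMap_eq_smul_one]
    exact (LinearMap.range V.sliceFstMap).smul_mem c
      (sliceFst_closed _ V.mul_mem_range_sliceFstMap V.op V.star_mul_op fun _ => Iff.rfl).1
  star_mem' := fun {x} hx =>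
    (sliceFst_closed _ V.mul_mem_range_sliceFstMap V.op V.star_mul_op fun _ => Iff.rfl).2 x hx

/-- The concrete dual C*-algebra `Ŝ = {(id ⊗ ω)(V) : ω ∈ B(H)*} ⊆ B(H)`. -/
def dualS : StarSubalgebra ℂ (Module.End ℂ H) where
  carrier := {x | ∃ ω : Module.Dual ℂ (Module.End ℂ H), sliceSnd ω V.op = x}
  mul_mem' := fun {x y} hx hy => V.mul_mem_range_sliceSndMap x hx y hy
  add_mem' := fun {_ _} hx hy => (LinearMap.range V.sliceSndMap).add_mem hx hy
  algebraMap_mem' c := by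
    rw [Algebra.algebraMap_eq_smul_one]
    exact (LinearMap.range V.sliceSndMap).smul_mem c
      (sliceSnd_closed _ V.mul_mem_range_sliceSndMap V.op V.star_mul_op fun _ => Iff.rfl).1
  star_mem' := fun {x} hx =>
    (sliceSnd_closed _ V.mul_mem_range_sliceSndMap V.op V.star_mul_op fun _ => Iff.rfl).2 x hx

/-! #### The coproduct of `S` -/

/-- The canonical embedding `S ⊗ S → B(H ⊗ H)`. -/
def tensorEmbedding : V.S ⊗[ℂ] V.S →ₗ[ℂ] Module.End ℂ (H ⊗[ℂ] H) :=
  (homTensorHomEquiv ℂ H H H H).toLinearMap ∘ₗ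
    TensorProduct.map V.S.subtype.toLinearMap V.S.subtype.toLinearMap

theorem tensorEmbedding_tmul (x y : V.S) :
    V.tensorEmbedding (x ⊗ₜ y) = TensorProduct.map (x : Module.End ℂ H) (y : Module.End ℂ H) := by
  rw [← LinearEquiv.apply_symm_apply (homTensorHomEquiv ℂ H H H H) (TensorProduct.map _ _),
    homTensorHomEquiv_symm_map]
  rfl

theorem tensorEmbedding_injective : Function.Injective V.tensorEmbedding := by
  refine (homTensorHomEquiv ℂ H H H H).injective.comp ?_
  exact TensorProduct.map_injective_of_flat_flat _ _ Subtype.val_injective Subtype.val_injective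

/-- The map `x ↦ V (x ⊗ 1) V*` from `S` to `B(H ⊗ H)`. -/
def coproductAux : V.S →ₗ[ℂ] Module.End ℂ (H ⊗[ℂ] H) :=
  LinearMap.mulLeft ℂ V.op ∘ₗ LinearMap.mulRight ℂ (star V.op) ∘ₗ
    (TensorProduct.mapBilinear (.id ℂ) H H H H).flip 1 ∘ₗ V.S.subtype.toLinearMap

theorem coproductAux_mem (x : V.S) : V.coproductAux x ∈ LinearMap.range V.tensorEmbedding := by
  obtain ⟨x, ω, rfl⟩ := x
  have h : V.coproductAux ⟨sliceFst ω V.op, ω, rfl⟩ =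
      sliceFst ω (leg12 V.op * leg13 V.op) := by
    rw [V.leg12_mul_leg13, sliceFst_leg23_leg12_leg23, mul_assoc]
    rfl
  rw [h]
  let b := Module.finBasis ℂ (Module.End ℂ H)
  let s : Fin _ → V.S := fun i => ⟨sliceFst (b.coord i) V.op, _, rfl⟩
  have hV : V.op = ∑ i, TensorProduct.map (b i) (s i : Module.End ℂ H) :=
    eq_sum_map_sliceFst b V.op
  have h12 : leg12 V.op =
      ∑ i, TensorProduct.map (b i) (TensorProduct.map (s i : Module.End ℂ H) 1) := by
    conv_lhs => rw [hV]
    rw [← AddMonoidHom.mk'_apply leg12 leg12_add, map_sum]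
    exact Finset.sum_congr rfl fun i _ => leg12_map _ _
  have h13 : leg13 V.op =
      ∑ i, TensorProduct.map (b i) (TensorProduct.map 1 (s i : Module.End ℂ H)) := by
    conv_lhs => rw [hV]
    rw [← AddMonoidHom.mk'_apply leg13 leg13_add, map_sum]
    exact Finset.sum_congr rfl fun i _ => leg13_map _ _
  rw [h12, h13, Finset.sum_mul_sum, map_sum]
  refine Submodule.sum_mem _ fun i _ => ?_
  rw [map_sum]
  refine Submodule.sum_mem _ fun j _ => ?_
  rw [← TensorProduct.map_mul, ← TensorProduct.map_mul, sliceFst_map, mul_one, one_mul]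
  exact Submodule.smul_mem _ _ ⟨s i ⊗ₜ s j, V.tensorEmbedding_tmul _ _⟩

/-- The coproduct `δ : S → S ⊗ S`, `δ(x) = V (x ⊗ 1) V*`. -/
def coproduct : V.S →ₗ[ℂ] V.S ⊗[ℂ] V.S :=
  (LinearEquiv.ofInjective V.tensorEmbedding V.tensorEmbedding_injective).symm.toLinearMap ∘ₗ
    V.coproductAux.codRestrict _ V.coproductAux_mem

/-- The defining property of the coproduct, inside `B(H ⊗ H)`. -/
theorem tensorEmbedding_coproduct (x : V.S) :
    V.tensorEmbedding (V.coproduct x) =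
      V.op * TensorProduct.map (x : Module.End ℂ H) 1 * star V.op := by
  rw [mul_assoc]
  exact congrArg Subtype.val
    ((LinearEquiv.ofInjective V.tensorEmbedding V.tensorEmbedding_injective).apply_symm_apply _)

/-- A *-automorphism `α` of `S` is a Hopf *-automorphism if `δ ∘ α = (α ⊗ α) ∘ δ`
(counit and antipode are determined by the coproduct, hence preserved). -/
def IsHopfAut (α : V.S ≃⋆ₐ[ℂ] V.S) : Prop :=
  ∀ x, V.coproduct (α x) =
    TensorProduct.map (α : V.S →ₗ[ℂ] V.S) (α : V.S →ₗ[ℂ] V.S) (V.coproduct x)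

/-! #### The duality between `S` and `Ŝ` -/

/-- Each element of `S` is a slice `(ω ⊗ id)(V)`; the functional `ω` is chosen linearly here. -/
theorem exists_sliceFst_section : ∃ r : V.S →ₗ[ℂ] Module.Dual ℂ (Module.End ℂ H),
    ∀ x : V.S, sliceFst (r x) V.op = x := by
  let f : Module.Dual ℂ (Module.End ℂ H) →ₗ[ℂ] V.S :=
    V.sliceFstMap.codRestrict (Subalgebra.toSubmodule V.S.toSubalgebra) fun ω => ⟨ω, rfl⟩
  have hf : LinearMap.range f = ⊤ := by
    rw [LinearMap.range_eq_top]
    rintro ⟨x, ω, rfl⟩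
    exact ⟨ω, rfl⟩
  obtain ⟨g, hg⟩ := f.exists_rightInverse_of_surjective hf
  exact ⟨g, fun x => congrArg Subtype.val (LinearMap.congr_fun hg x)⟩

/-- The pairing `β : S × Ŝ → ℂ`, `β((ω ⊗ id)(V), (id ⊗ ρ)(V)) = (ω ⊗ ρ)(V)`. It is evaluated as
`β((ω ⊗ id)(V), y) = ω(y)`, which does not depend on the choice of `ω`, see `pairing_slice`. -/
def pairing : V.S →ₗ[ℂ] V.dualS →ₗ[ℂ] ℂ :=
  (LinearMap.lcomp ℂ ℂ V.dualS.subtype.toLinearMap) ∘ₗ V.exists_sliceFst_section.choose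

/-- `β((ω ⊗ id)(V), (id ⊗ ρ)(V)) = ρ((ω ⊗ id)(V))`. -/
theorem pairing_slice (x : V.S) (ρ : Module.Dual ℂ (Module.End ℂ H)) :
    V.pairing x ⟨sliceSnd ρ V.op, ρ, rfl⟩ = ρ x := by
  conv_rhs => rw [← V.exists_sliceFst_section.choose_spec x, apply_sliceFst_eq]
  rfl

theorem pairing_slice_slice (ω ρ : Module.Dual ℂ (Module.End ℂ H)) :
    V.pairing ⟨sliceFst ω V.op, ω, rfl⟩ ⟨sliceSnd ρ V.op, ρ, rfl⟩ = ρ (sliceFst ω V.op) :=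
  V.pairing_slice _ ρ

theorem pairing_flip_bijective : Function.Bijective V.pairing.flip := by
  constructor
  · rw [← LinearMap.ker_eq_bot, LinearMap.ker_eq_bot']
    rintro ⟨y, ρ, rfl⟩ h
    apply Subtype.ext
    refine (Module.forall_dual_apply_eq_zero_iff ℂ _).mp fun ω => ?_
    have h' := LinearMap.congr_fun h ⟨sliceFst ω V.op, ω, rfl⟩
    rw [LinearMap.flip_apply, pairing_slice_slice, apply_sliceFst_eq] at h'
    exact h'
  · intro f
    obtain ⟨ρ, hρ⟩ := LinearMap.exists_extend
      (p := Subalgebra.toSubmodule V.S.toSubalgebra) f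
    refine ⟨⟨sliceSnd ρ V.op, ρ, rfl⟩, LinearMap.ext fun x => ?_⟩
    rw [LinearMap.flip_apply, pairing_slice]
    exact LinearMap.congr_fun hρ x

/-- The identification of `Ŝ` with the dual space of `S`, `y ↦ β(·, y)`. -/
def dualEquiv : V.dualS ≃ₗ[ℂ] Module.Dual ℂ V.S :=
  LinearEquiv.ofBijective V.pairing.flip V.pairing_flip_bijective

/-- The action on the dual `Ŝ` of an automorphism `α` of `S`: the transpose of `α`. -/
def dualAction (α : V.S ≃⋆ₐ[ℂ] V.S) : V.dualS →ₗ[ℂ] V.dualS :=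
  V.dualEquiv.symm.toLinearMap ∘ₗ Module.Dual.transpose (α : V.S →ₗ[ℂ] V.S) ∘ₗ
    V.dualEquiv.toLinearMap

/-- The defining property of the dual action: `β(x, α̂(y)) = β(α(x), y)`. -/
theorem pairing_dualAction (α : V.S ≃⋆ₐ[ℂ] V.S) (x : V.S) (y : V.dualS) :
    V.pairing x (V.dualAction α y) = V.pairing (α x) y :=
  LinearMap.congr_fun (V.dualEquiv.apply_symm_apply
    (Module.Dual.transpose (α : V.S →ₗ[ℂ] V.S) (V.dualEquiv y))) x

end MultiplicativeUnitary

/-- A self-map of an algebra is inner if it is conjugation by an invertible element. -/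
def IsInnerMap {A : Type*} [Monoid A] (φ : A → A) : Prop :=
  ∃ g : Aˣ, ∀ y, φ y = g * y * ↑g⁻¹

end

open scoped TensorProduct

/-! ### Slices determine an operator and turn conjugation of one leg into algebra. -/

section Slices

variable {E F : Type*} [AddCommGroup E] [Module ℂ E] [FiniteDimensional ℂ E]
  [AddCommGroup F] [Module ℂ F] [FiniteDimensional ℂ F]

/-! The dual action is the transpose of `α`, so on slices it acts by moving conjugation by `u` into
the functional: it sends `(id ⊗ ρ)(V)` to `(id ⊗ ρ)((1 ⊗ u) V (1 ⊗ u*))`. If it is also conjugation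
by `g`, comparing all slices gives `(1 ⊗ u) V (1 ⊗ u*) = (g ⊗ 1) V (g⁻¹ ⊗ 1)`
(`conj_snd_eq_conj_fst`). Hence `h ⊗ u` commutes with `V`, where `h = g⁻¹` lies in `Ŝ`.

It remains to make `h` unitary, by polar decomposition. The commutant of the unitary `V` is closed
under adjoints, so it contains `(h ⊗ u)* (h ⊗ u) = h* h ⊗ 1`, the second leg cancelling because `u`
is unitary. In finite dimension `r = (h* h)^(-1/2)` is a polynomial in `h* h`
(`exists_aeval_inv_modulus`); hence `r` lies in `Ŝ` and `r ⊗ 1` commutes with `V`. The unitary part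
`h r` of `h` is the required element. -/

theorem ext_sliceSnd {X Y : Module.End ℂ (E ⊗[ℂ] F)} (h : ∀ ρ, sliceSnd ρ X = sliceSnd ρ Y) :
    X = Y := by
  rw [eq_sum_map_sliceSnd (Module.finBasis ℂ (Module.End ℂ F)) X,
    eq_sum_map_sliceSnd (Module.finBasis ℂ (Module.End ℂ F)) Y]
  simp only [h]

/-- Slicing the second leg is a bimodule map over operators on the first; on the `Ŝ` side this
produces conjugation by `g`. -/
theorem sliceSnd_conj_fst (ρ : Module.Dual ℂ (Module.End ℂ F)) (a b : Module.End ℂ E)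
    (X : Module.End ℂ (E ⊗[ℂ] F)) :
    sliceSnd ρ (TensorProduct.map a 1 * X * TensorProduct.map b 1) = a * sliceSnd ρ X * b := by
  induction X using endTensor_induction with
  | h0 => simp
  | hm x y => simp [← TensorProduct.map_mul, sliceSnd_map]
  | ha X Y hX hY => simp [mul_add, add_mul, hX, hY]

/-- Operators on the leg being sliced are absorbed into the functional; this is how `u` enters the
dual action. -/
theorem sliceSnd_conj_snd (ρ : Module.Dual ℂ (Module.End ℂ F)) (a b : Module.End ℂ F)
    (X : Module.End ℂ (E ⊗[ℂ] F)) :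
    sliceSnd ρ (TensorProduct.map 1 a * X * TensorProduct.map 1 b) =
      sliceSnd (ρ ∘ₗ LinearMap.mulLeft ℂ a ∘ₗ LinearMap.mulRight ℂ b) X := by
  induction X using endTensor_induction with
  | h0 => simp
  | hm x y => simp [← TensorProduct.map_mul, sliceSnd_map, mul_assoc]
  | ha X Y hX hY => simp [mul_add, add_mul, hX, hY]

end Slices

/-! ### Polar decomposition by polynomial functional calculus. -/

section Polar

variable {H : Type*} [NormedAddCommGroup H] [InnerProductSpace ℂ H] [FiniteDimensional ℂ H]

/-- The inverse modulus `(h* h)^(-1/2)` of an injective operator `h` is a polynomial in `h* h`. -/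
theorem exists_aeval_inv_modulus (h : Module.End ℂ H) (hinj : Function.Injective h) :
    ∃ f : Polynomial ℂ, star (Polynomial.aeval (star h * h) f) = Polynomial.aeval (star h * h) f ∧
      Polynomial.aeval (star h * h) f * (star h * h) * Polynomial.aeval (star h * h) f = 1 := by
  set p : Module.End ℂ H := star h * h with hp
  have hps : star p = p := by simp [hp]
  have hsym : p.IsSymmetric := by
    rw [LinearMap.isSymmetric_iff_isSelfAdjoint]; exact hps
  let e := hsym.eigenvectorBasis rfl
  let l := hsym.eigenvalues rfl
  have hpe : ∀ i, p (e i) = (l i : ℂ) • e i := hsym.apply_eigenvectorBasis rfl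
  -- The eigenvalue at a unit eigenvector `e i` is `‖h (e i)‖ ^ 2`, nonzero since `h` is injective.
  have hpos : ∀ i, 0 < l i := by
    intro i
    have h1 : inner ℂ (e i) (p (e i)) = inner ℂ (h (e i)) (h (e i)) :=
      LinearMap.adjoint_inner_right h (e i) (h (e i))
    have h2 : inner ℂ (e i) (p (e i)) = (l i : ℂ) := by
      rw [hpe, inner_smul_right, inner_self_eq_norm_sq_to_K, e.orthonormal.1 i]; simp
    rw [h2, inner_self_eq_norm_sq_to_K] at h1
    have h3 : l i = ‖h (e i)‖ ^ 2 := by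
      apply Complex.ofReal_injective
      rw [h1]; simp
    have h4 : h (e i) ≠ 0 := by
      rw [Ne, ← map_zero h, hinj.eq_iff]; exact e.orthonormal.ne_zero i
    rw [h3]; positivity
  -- The nodes form the set of eigenvalues, so multiplicities cause no clash between nodes.
  -- Interpolating over `ℝ` makes the coefficients real, which is what makes the resulting operator
  -- self-adjoint.
  let f : Polynomial ℝ := Lagrange.interpolate (Finset.univ.image l) id fun x => (√x)⁻¹
  have hf : ∀ i, f.eval (l i) = (√(l i))⁻¹ := fun i =>
    Lagrange.eval_interpolate_at_node (v := id) _ (Set.injOn_id _)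
      (Finset.mem_image_of_mem l (Finset.mem_univ i))
  refine ⟨f.map (algebraMap ℝ ℂ), ?_, ?_⟩
  · rw [Polynomial.aeval_eq_sum_range, star_sum]
    refine Finset.sum_congr rfl fun n _ => ?_
    rw [star_smul, star_pow, hps, Polynomial.coeff_map]
    simp
  · have key : ∀ i, Polynomial.aeval p (f.map (algebraMap ℝ ℂ)) (e i) =
        (((√(l i))⁻¹ : ℝ) : ℂ) • e i := by
      intro i
      rw [Module.End.aeval_apply_of_hasEigenvector
        (Module.End.hasEigenvector_iff.2
          ⟨Module.End.mem_eigenspace_iff.2 (hpe i), e.orthonormal.ne_zero i⟩), ← hf i,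
        Polynomial.eval_map_algebraMap, ← Complex.coe_algebraMap, Polynomial.aeval_algebraMap_apply,
        Polynomial.aeval_def, Polynomial.eval₂_eq_eval_map]
      simp
    refine e.toBasis.ext fun i => ?_
    have hs : (√(l i))⁻¹ * (l i * (√(l i))⁻¹) = 1 := by
      have := Real.sqrt_pos.2 (hpos i)
      field_simp
      exact (Real.sq_sqrt (hpos i).le).symm
    simp only [OrthonormalBasis.coe_toBasis, Module.End.mul_apply, key, map_smul, hpe, smul_smul,
      Module.End.one_apply]
    rw [show ∀ c : ℂ, c = 1 → c • e i = e i by rintro _ rfl; simp]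
    rw [← Complex.ofReal_one, ← hs]; push_cast; ring

theorem aeval_mem_of_mem {R B : Type*} [CommSemiring R] [Semiring B] [Algebra R B]
    {A : Subalgebra R B} {a : B} (ha : a ∈ A) (f : Polynomial R) : Polynomial.aeval a f ∈ A :=
  Algebra.adjoin_le (Set.singleton_subset_iff.2 ha) (Polynomial.aeval_mem_adjoin_singleton R a)

/-- Taking adjoints shows that `star X` commutes with `star V`, which is the inverse of `V`, hence
with `V` itself. -/
theorem commute_star_of_mem_unitary {R : Type*} [Monoid R] [StarMul R] {X V : R}
    (hV : V ∈ unitary R) (h : Commute X V) : Commute (star X) V := by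
  obtain ⟨h1, h2⟩ := Unitary.mem_iff.mp hV
  have h3 : star V * star X = star X * star V := by rw [← star_mul, ← star_mul, h.eq]
  calc star X * V = V * (star V * star X) * V := by rw [← mul_assoc, h2, one_mul]
    _ = V * star X := by rw [h3, mul_assoc, mul_assoc, h1, mul_one]

end Polar

/-! ### The dual action of an implemented automorphism. -/

namespace MultiplicativeUnitary

variable {H : Type*} [NormedAddCommGroup H] [InnerProductSpace ℂ H] [FiniteDimensional ℂ H]
  (V : MultiplicativeUnitary H)

/-- If `α` is implemented by `u` then `α̂((id ⊗ ρ)(V)) = (id ⊗ ρ(u · u*))(V)`. -/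
theorem dualAction_slice (u : Module.End ℂ H) (α : V.S ≃⋆ₐ[ℂ] V.S)
    (hαu : ∀ x : V.S, (α x : Module.End ℂ H) = u * (x : Module.End ℂ H) * star u)
    (ρ : Module.Dual ℂ (Module.End ℂ H)) :
    V.dualAction α ⟨sliceSnd ρ V.op, ρ, rfl⟩ =
      ⟨sliceSnd (ρ ∘ₗ LinearMap.mulLeft ℂ u ∘ₗ LinearMap.mulRight ℂ (star u)) V.op, _, rfl⟩ := by
  -- Elements of `Ŝ` are separated by pairing with `S`; against `x` both sides give `ρ (u x u*)`.
  refine V.pairing_flip_bijective.1 (LinearMap.ext fun x => ?_)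
  rw [LinearMap.flip_apply, LinearMap.flip_apply, pairing_dualAction, pairing_slice, pairing_slice,
    hαu]
  simp [mul_assoc]

/-- If `α` is implemented by `u` and `α̂` by `g`, then `(1 ⊗ u) V (1 ⊗ u*) = (g ⊗ 1) V (g⁻¹ ⊗ 1)`. -/
theorem conj_snd_eq_conj_fst (u : Module.End ℂ H) (α : V.S ≃⋆ₐ[ℂ] V.S)
    (hαu : ∀ x : V.S, (α x : Module.End ℂ H) = u * (x : Module.End ℂ H) * star u)
    (g : V.dualSˣ) (hg : ∀ y, V.dualAction α y = g * y * ↑g⁻¹) :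
    TensorProduct.map 1 u * V.op * TensorProduct.map 1 (star u) =
      TensorProduct.map ((g : V.dualS) : Module.End ℂ H) 1 * V.op *
        TensorProduct.map ((↑g⁻¹ : V.dualS) : Module.End ℂ H) 1 := by
  refine ext_sliceSnd fun ρ => ?_
  rw [sliceSnd_conj_fst, sliceSnd_conj_snd]
  have h := congrArg Subtype.val
    ((V.dualAction_slice u α hαu ρ).symm.trans (hg ⟨sliceSnd ρ V.op, ρ, rfl⟩))
  exact h

end MultiplicativeUnitary

/-! ### From an invertible to a unitary implementer. -/

theorem mainTheorem2 {H : Type*} [NormedAddCommGroup H] [InnerProductSpace ℂ H]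
    [FiniteDimensional ℂ H] (V : MultiplicativeUnitary H)
    (u : Module.End ℂ H) (hu : u ∈ unitary (Module.End ℂ H))
    (α : V.S ≃⋆ₐ[ℂ] V.S)
    (hαu : ∀ x : V.S, (α x : Module.End ℂ H) = u * (x : Module.End ℂ H) * star u)
    (hα : V.IsHopfAut α) (hinner : IsInnerMap (V.dualAction α)) :
    ∃ v : Module.End ℂ H, v ∈ unitary (Module.End ℂ H) ∧ v ∈ V.dualS ∧
      Commute (TensorProduct.map v u : Module.End ℂ (H ⊗[ℂ] H)) V.op := by
  obtain ⟨g, hg⟩ := hinner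
  obtain ⟨hu1, hu2⟩ := Unitary.mem_iff.mp hu
  have hconj := V.conj_snd_eq_conj_fst u α hαu g hg
  set k : Module.End ℂ H := ((g : V.dualS) : Module.End ℂ H)
  set h : Module.End ℂ H := ((↑g⁻¹ : V.dualS) : Module.End ℂ H)
  have hhk : h * k = 1 := congrArg Subtype.val g.inv_mul
  have hkh : k * h = 1 := congrArg Subtype.val g.mul_inv
  have hmem : h ∈ V.dualS := (↑g⁻¹ : V.dualS).2
  have hinj : Function.Injective h := fun x y hxy => by
    have := congrArg k hxy
    rwa [← Module.End.mul_apply, ← Module.End.mul_apply, hkh] at this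
  have hcomm : Commute (TensorProduct.map h u) V.op := by
    calc TensorProduct.map h u * V.op
        = TensorProduct.map h 1 * (TensorProduct.map 1 u * V.op * TensorProduct.map 1 (star u)) *
            TensorProduct.map 1 u := by
          simp only [mul_assoc, ← TensorProduct.map_mul, hu1, TensorProduct.map_one, mul_one]
          rw [← mul_assoc, ← TensorProduct.map_mul, one_mul, mul_one]
      _ = V.op * TensorProduct.map h u := by
          rw [hconj]
          simp only [← mul_assoc, ← TensorProduct.map_mul, hhk, one_mul, TensorProduct.map_one]
          rw [mul_assoc, ← TensorProduct.map_mul, one_mul, mul_one]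
  have hcommp : Commute (TensorProduct.map (star h * h) (1 : Module.End ℂ H)) V.op := by
    have h1 := (commute_star_of_mem_unitary V.mem_unitary hcomm).mul_left hcomm
    rwa [star_map_tensor, ← TensorProduct.map_mul, hu1] at h1
  obtain ⟨f, hfs, hf1⟩ := exists_aeval_inv_modulus h hinj
  have hcommr : Commute (TensorProduct.map (Polynomial.aeval (star h * h) f)
      (1 : Module.End ℂ H)) V.op := by
    -- The operators `a` with `a ⊗ 1` commuting with `V` form a subalgebra, so polynomials in `star
    -- h * h` stay inside it.
    have h1 : Polynomial.aeval (star h * h) f ∈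
        (Subalgebra.centralizer ℂ {V.op}).comap (Module.End.rTensorAlgHom ℂ H H) :=
      aeval_mem_of_mem (Subalgebra.mem_comap .. |>.2 <| Subalgebra.mem_centralizer_iff ℂ |>.2 <| by
        rintro _ rfl; exact hcommp.eq.symm) f
    exact (Subalgebra.mem_centralizer_iff ℂ |>.1 h1 V.op rfl).symm
  refine ⟨h * Polynomial.aeval (star h * h) f, ?_, ?_, ?_⟩
  · have h1 : star (h * Polynomial.aeval (star h * h) f) * (h * Polynomial.aeval (star h * h) f)
        = 1 := by
      rw [star_mul, hfs, ← hf1]; simp only [mul_assoc]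
    -- In finite dimension a left inverse is also a right inverse.
    exact Unitary.mem_iff.2 ⟨h1, mul_eq_one_comm.1 h1⟩
  · have hp : star h * h ∈ V.dualS := mul_mem (star_mem hmem) hmem
    exact mul_mem hmem (aeval_mem_of_mem (A := V.dualS.toSubalgebra) hp f)
  · have h1 := hcomm.mul_left hcommr
    rwa [← TensorProduct.map_mul, mul_one] at h1
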